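/- On $M=\mathbb{R}^2$ let $v_1 = x\frac{\partial}{\partial x}+y\frac{\partial}{\partial y}$ and $v_2=-y\frac{\partial}{\partial x}+x\frac{\partial}{\partial y}$, let $E\subseteq \mathrm{Vect}(\mathbb{R}^2)$ be the (free, involutive) $C^\infty(\mathbb{R}^2)$-submodule generated by $v_1$ and $v_2$, and let $\Pi_E = v_1\wedge v_2=(x^2+y^2)\frac{\partial}{\partial x}\wedge\frac{\partial}{\partial y}$ be the associated Poisson structure. Let ${}^E H^\ast(\mathbb{R}^2)$ be the $E$-cohomology, i.e. the cohomology of the complex of $E$-forms (alternating $C^\infty(\mathbb{R}^2)$-multilinear maps $E\times\dots\times E\to C^\infty(\mathbb{R}^2)$) with the differential $$d\omega(V_0,\dots,V_p)=\sum_i(-1)^iV_i\bigl(\omega(V_0,\dots,\hat V_i,\dots,V_p)\bigr)+\sum_{i<j}(-1)^{i+j}\omega([V_i,V_j],V_0,\dots,\hat V_i,\dots,\hat V_j,\dots,V_p),$$ and let $H^\ast_{\Pi_E}(\mathbb{R}^2)$ be the Poisson cohomology, i.e. the cohomology of the complex of multivector fields on $\mathbb{R}^2$ with differential $[\Pi_E,\cdot]$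 (Schouten bracket). Then, as real vector spaces, $${}^E H^2(\mathbb{R}^2)\cong\mathbb{R},\qquad H^2_{\Pi_E}(\mathbb{R}^2)\cong\mathbb{R}^2 .$$ In particular ${}^E H^2(\mathbb{R}^2)\not\cong H^2_{\Pi_E}(\mathbb{R}^2)$, so the $E$-cohomology is not isomorphic to the Poisson cohomology as a graded real vector space. -/

import Mathlib

noncomputable section

/-! ### The Koszul formula

For a bracket `br` on `L` and an action `act` of `L` on `M`, the differential of a `p`-cochain
`ω` is
`dω(V₀, …, V_p) = ∑ᵢ (-1)ⁱ Vᵢ(ω(V₀, …, V̂ᵢ, …, V_p))`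
`    + ∑_{i < j} (-1)^(i+j) ω([Vᵢ, Vⱼ], V₀, …, V̂ᵢ, …, V̂ⱼ, …, V_p)`. -/

/-- The first sum in the Koszul formula. -/
def koszulAction {L M : Type*} [AddCommGroup M] (act : L → M → M) {p : ℕ}
    (ω : (Fin p → L) → M) (V : Fin (p + 1) → L) : M :=
  ∑ i : Fin (p + 1), (-1 : ℤ) ^ (i : ℕ) • act (V i) (ω (i.removeNth V))

/-- The second sum in the Koszul formula; it is empty for `p = 0`. For `p = q + 1` the sum is over
the positions `i < j` in `Fin (q + 2)`; as `i` is not the last position, it is written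
`i.castSucc` with `i : Fin (q + 1)`, and this `i` is also its position once `V j` is removed. -/
def koszulBracket {L M : Type*} [AddCommGroup M] (br : L → L → L) :
    {p : ℕ} → ((Fin p → L) → M) → (Fin (p + 1) → L) → M
  | 0, _, _ => 0
  | q + 1, ω, V =>
    ∑ j : Fin (q + 2), ∑ i : Fin (q + 1),
      if i.castSucc < j then
        (-1 : ℤ) ^ ((i : ℕ) + (j : ℕ)) •
          ω (Fin.cons (br (V i.castSucc) (V j)) (i.removeNth (j.removeNth V)))
      else 0

/-- The Koszul formula. -/
def koszul {L M : Type*} [AddCommGroup M] (br : L → L → L) (act : L → M → M) {p : ℕ}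
    (ω : (Fin p → L) → M) (V : Fin (p + 1) → L) : M :=
  koszulAction act ω V + koszulBracket br ω V

theorem koszul_add {L M : Type*} [AddCommGroup M] (br : L → L → L) (act : L → M → M)
    (h : ∀ v a b, act v (a + b) = act v a + act v b) {p : ℕ} (ω η : (Fin p → L) → M) :
    koszul br act (ω + η) = koszul br act ω + koszul br act η := by
  funext V
  have h2 : koszulBracket br (ω + η) V = koszulBracket br ω V + koszulBracket br η V := by
    cases p with
    | zero => simp [koszulBracket]
    | succ q =>
      simp only [koszulBracket, ← Finset.sum_add_distrib]
      refine Finset.sum_congr rfl fun j _ => Finset.sum_congr rfl fun i _ => ?_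
      split_ifs <;> simp
  have h1 : koszulAction act (ω + η) V = koszulAction act ω V + koszulAction act η V := by
    simp only [koszulAction, ← Finset.sum_add_distrib, Pi.add_apply, h, smul_add]
  simp only [koszul, Pi.add_apply, h1, h2]
  abel

theorem koszul_smul {R L M : Type*} [CommRing R] [AddCommGroup M] [Module R M]
    (br : L → L → L) (act : L → M → M) (h : ∀ v (r : R) a, act v (r • a) = r • act v a)
    {p : ℕ} (r : R) (ω : (Fin p → L) → M) :
    koszul br act (r • ω) = r • koszul br act ω := by
  funext V
  have h2 : koszulBracket br (r • ω) V = r • koszulBracket br ω V := by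
    cases p with
    | zero => simp [koszulBracket]
    | succ q =>
      simp only [koszulBracket, Finset.smul_sum]
      refine Finset.sum_congr rfl fun j _ => Finset.sum_congr rfl fun i _ => ?_
      split_ifs
      · simp only [Pi.smul_apply]; rw [smul_comm]
      · simp
  have h1 : koszulAction act (r • ω) V = r • koszulAction act ω V := by
    simp only [koszulAction, Finset.smul_sum, Pi.smul_apply, h]
    exact Finset.sum_congr rfl fun i _ => smul_comm _ _ _
  simp only [koszul, Pi.smul_apply, h1, h2, smul_add]

/-- The Koszul differential as a linear map on arbitrary `M`-valued functions of tuples. -/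
def koszulD {R L M : Type*} [CommRing R] [AddCommGroup M] [Module R M]
    (br : L → L → L) (act : L → M →ₗ[R] M) (p : ℕ) :
    ((Fin p → L) → M) →ₗ[R] ((Fin (p + 1) → L) → M) where
  toFun ω := koszul br (fun v a => act v a) ω
  map_add' ω η := koszul_add _ _ (by simp) ω η
  map_smul' r ω := koszul_smul _ _ (by simp) r ω

section Cohomology

variable {R : Type*} [CommRing R] {C : ℕ → Type*} [∀ p, AddCommGroup (C p)] [∀ p, Module R (C p)]

/-- The cocycles of degree `p` in the graded subspace `Ω` of `C`. -/
def cocycles (d : ∀ p, C p →ₗ[R] C (p + 1)) (Ω : ∀ p, Submodule R (C p)) (p : ℕ) :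
    Submodule R (C p) :=
  Ω p ⊓ LinearMap.ker (d p)

/-- The coboundaries of degree `p` in the graded subspace `Ω` of `C`. -/
def coboundaries (d : ∀ p, C p →ₗ[R] C (p + 1)) (Ω : ∀ p, Submodule R (C p)) :
    (p : ℕ) → Submodule R (C p)
  | 0 => ⊥
  | p + 1 => Ω (p + 1) ⊓ (Ω p).map (d p)

/-- The cohomology of `(Ω, d)` in degree `p`: cocycles modulo coboundaries. -/
abbrev cohomology (d : ∀ p, C p →ₗ[R] C (p + 1)) (Ω : ∀ p, Submodule R (C p)) (p : ℕ) : Type _ :=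
  cocycles d Ω p ⧸ (coboundaries d Ω p).submoduleOf (cocycles d Ω p)

end Cohomology

/-! ### `E`-forms and `E`-cohomology

`A` is the algebra of smooth functions, and vector fields are the derivations of `A`. An involutive
submodule `E` of the vector fields is a `LieRinehartSubalgebra A (Derivation ℝ A A)`: a
sub-`A`-module closed under the Lie bracket of vector fields. -/

section ECohomology

variable {A : Type*} [CommRing A] [Algebra ℝ A]

/-- `E`-forms of degree `p`: alternating `A`-multilinear maps `E × ⋯ × E → A`. When `E` is locally
free, with `E`-tangent bundle `ᴱTM`, these are the sections of `⋀ᵖ (ᴱTM)*`. -/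
def EForm (E : LieRinehartSubalgebra A (Derivation ℝ A A)) (p : ℕ) :
    Submodule ℝ ((Fin p → E) → A) where
  carrier := {ω | ∃ α : E [⋀^Fin p]→ₗ[A] A, ⇑α = ω}
  zero_mem' := ⟨0, rfl⟩
  add_mem' := by
    rintro _ _ ⟨α, rfl⟩ ⟨β, rfl⟩
    exact ⟨α + β, rfl⟩
  smul_mem' := by
    rintro r _ ⟨α, rfl⟩
    exact ⟨r • α, rfl⟩

/-- The differential of `E`-forms: the Koszul formula for the Lie bracket of vector fields and the
action of vector fields on functions. -/
def EForm.d (E : LieRinehartSubalgebra A (Derivation ℝ A A)) (p : ℕ) :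
    ((Fin p → E) → A) →ₗ[ℝ] ((Fin (p + 1) → E) → A) :=
  koszulD (fun V W : E => ⁅V, W⁆) (fun V : E => ((V : Derivation ℝ A A) : A →ₗ[ℝ] A)) p

/-- `E`-cohomology in degree `p`. -/
abbrev ECohomology (E : LieRinehartSubalgebra A (Derivation ℝ A A)) (p : ℕ) : Type _ :=
  cohomology (EForm.d E) (EForm E) p

end ECohomology

/-! ### Poisson cohomology -/

section PoissonCohomology

variable {A : Type*} [CommRing A] [Algebra ℝ A]

/-- A Poisson structure on `A`: a Lie bracket that is a derivation in each argument. -/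
structure PoissonStructure (A : Type*) [CommRing A] [Algebra ℝ A] where
  bracket : A →ₗ[ℝ] A →ₗ[ℝ] A
  bracket_self : ∀ f, bracket f f = 0
  jacobi : ∀ f g h,
    bracket f (bracket g h) + bracket g (bracket h f) + bracket h (bracket f g) = 0
  leibniz : ∀ f g h, bracket f (g * h) = g * bracket f h + h * bracket f g

/-- Multivector fields of degree `p`: alternating `ℝ`-multilinear maps `A × ⋯ × A → A` that are
derivations in each argument, a section `P` of `⋀ᵖ TM` being the map
`(f₁, …, f_p) ↦ P(df₁, …, df_p)`. -/
def Multivector (A : Type*) [CommRing A] [Algebra ℝ A] (p : ℕ) :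
    Submodule ℝ ((Fin p → A) → A) where
  carrier := {P | (∃ Q : A [⋀^Fin p]→ₗ[ℝ] A, ⇑Q = P) ∧
    ∀ (F : Fin p → A) (i : Fin p) (g h : A),
      P (Function.update F i (g * h)) =
        g * P (Function.update F i h) + h * P (Function.update F i g)}
  zero_mem' := ⟨⟨0, rfl⟩, by simp⟩
  add_mem' := by
    rintro _ _ ⟨⟨P, rfl⟩, hP⟩ ⟨⟨Q, rfl⟩, hQ⟩
    refine ⟨⟨P + Q, rfl⟩, fun F i g h => ?_⟩
    simp only [Pi.add_apply, hP F i g h, hQ F i g h]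
    ring
  smul_mem' := by
    rintro r _ ⟨⟨P, rfl⟩, hP⟩
    refine ⟨⟨r • P, rfl⟩, fun F i g h => ?_⟩
    simp only [Pi.smul_apply, hP F i g h, smul_add, mul_smul_comm]

/-- The differential `P ↦ ± [Π, P]` on multivector fields (Schouten bracket with the Poisson
bivector), given by
`∑ᵢ (-1)ⁱ {fᵢ, P(f₀, …, f̂ᵢ, …, f_p)}`
`    + ∑_{i < j} (-1)^(i+j) P({fᵢ, fⱼ}, f₀, …, f̂ᵢ, …, f̂ⱼ, …, f_p)`. -/
def Multivector.d (π : PoissonStructure A) (p : ℕ) :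
    ((Fin p → A) → A) →ₗ[ℝ] ((Fin (p + 1) → A) → A) :=
  koszulD (fun f g => π.bracket f g) (fun f => π.bracket f) p

/-- Poisson cohomology in degree `p`. -/
abbrev PoissonCohomology (π : PoissonStructure A) (p : ℕ) : Type _ :=
  cohomology (Multivector.d π) (Multivector A) p

/-- The Poisson structure `v ∧ w`, i.e. `{f, g} = v(f) w(g) - w(f) v(g)`, for two commuting
vector fields `v`, `w`. -/
def PoissonStructure.wedge (v w : Derivation ℝ A A) (hvw : ∀ f, v (w f) = w (v f)) :
    PoissonStructure A where
  bracket := LinearMap.mk₂ ℝ (fun f g => v f * w g - w f * v g)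
    (by intros; simp; ring)
    (by intros; simp [smul_sub])
    (by intros; simp; ring)
    (by intros; simp [smul_sub])
  bracket_self f := by simp [mul_comm]
  jacobi f g h := by
    simp [hvw]
    ring
  leibniz f g h := by
    simp
    ring

end PoissonCohomology

/-! ### The elliptic structure on the plane -/

open scoped Manifold ContDiff

/-- Smooth functions on `ℝ²`. -/
abbrev SmoothPlane : Type := C^∞⟮𝓘(ℝ, ℝ × ℝ), ℝ × ℝ; ℝ⟯

namespace SmoothPlane

theorem contDiff (f : SmoothPlane) : ContDiff ℝ ∞ (f : ℝ × ℝ → ℝ) := f.contMDiff.contDiff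

theorem differentiableAt (f : SmoothPlane) (p : ℝ × ℝ) : DifferentiableAt ℝ (f : ℝ × ℝ → ℝ) p :=
  f.contDiff.differentiable (by simp) p

/-- The coordinate function `x`. -/
def x : SmoothPlane := ⟨fun p => p.1, contDiff_fst.contMDiff⟩

/-- The coordinate function `y`. -/
def y : SmoothPlane := ⟨fun p => p.2, contDiff_snd.contMDiff⟩

/-- The derivative in the constant direction `u`, as a vector field. -/
def dirDeriv (u : ℝ × ℝ) : Derivation ℝ SmoothPlane SmoothPlane :=
  Derivation.mk'
    { toFun := fun f => ⟨fun p => fderiv ℝ f p u,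
        ((f.contDiff.fderiv_right (m := ∞) (by simp)).clm_apply contDiff_const).contMDiff⟩
      map_add' := fun f g => by
        ext p
        change fderiv ℝ ((f : ℝ × ℝ → ℝ) + (g : ℝ × ℝ → ℝ)) p u = fderiv ℝ f p u + fderiv ℝ g p u
        rw [fderiv_add (f.differentiableAt p) (g.differentiableAt p)]
        rfl
      map_smul' := fun r f => by
        ext p
        change fderiv ℝ (r • (f : ℝ × ℝ → ℝ)) p u = r • fderiv ℝ f p u
        rw [fderiv_const_smul (f.differentiableAt p)]
        rfl }
    (fun f g => by
      ext p
      change fderiv ℝ ((f : ℝ × ℝ → ℝ) * (g : ℝ × ℝ → ℝ)) p u = f p * fderiv ℝ g p u + g p * fderiv ℝ f p u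
      rw [fderiv_mul (f.differentiableAt p) (g.differentiableAt p)]
      simp)

theorem dirDeriv_apply (u : ℝ × ℝ) (f : SmoothPlane) (p : ℝ × ℝ) :
    dirDeriv u f p = fderiv ℝ f p u := rfl

/-- `∂/∂x`. -/
def dx : Derivation ℝ SmoothPlane SmoothPlane := dirDeriv (1, 0)

/-- `∂/∂y`. -/
def dy : Derivation ℝ SmoothPlane SmoothPlane := dirDeriv (0, 1)

theorem dx_dy (f : SmoothPlane) : dx (dy f) = dy (dx f) := by
  ext p
  have h2 : DifferentiableAt ℝ (fderiv ℝ (f : ℝ × ℝ → ℝ)) p :=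
    (f.contDiff.fderiv_right (m := ∞) (by simp)).differentiable (by simp) p
  have hs : IsSymmSndFDerivAt ℝ (f : ℝ × ℝ → ℝ) p :=
    f.contDiff.contDiffAt.isSymmSndFDerivAt
      (by simpa using WithTop.coe_le_coe.2 (le_top : (2 : ℕ∞) ≤ ⊤))
  have key (u v : ℝ × ℝ) :
      dirDeriv u (dirDeriv v f) p = fderiv ℝ (fderiv ℝ (f : ℝ × ℝ → ℝ)) p u v := by
    change fderiv ℝ (fun q => fderiv ℝ (f : ℝ × ℝ → ℝ) q v) p u = _
    rw [fderiv_clm_apply h2 (differentiableAt_const v)]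
    simp
  change dirDeriv (1, 0) (dirDeriv (0, 1) f) p = dirDeriv (0, 1) (dirDeriv (1, 0) f) p
  rw [key, key]
  exact hs _ _

theorem dx_x : dx x = 1 := by
  ext p
  change fderiv ℝ (fun q : ℝ × ℝ => q.1) p (1, 0) = 1
  simp [fderiv_fst]

theorem dx_y : dx y = 0 := by
  ext p
  change fderiv ℝ (fun q : ℝ × ℝ => q.2) p (1, 0) = 0
  simp [fderiv_snd]

theorem dy_x : dy x = 0 := by
  ext p
  change fderiv ℝ (fun q : ℝ × ℝ => q.1) p (0, 1) = 0
  simp [fderiv_fst]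

theorem dy_y : dy y = 1 := by
  ext p
  change fderiv ℝ (fun q : ℝ × ℝ => q.2) p (0, 1) = 1
  simp [fderiv_snd]

/-- `v₁ = x ∂/∂x + y ∂/∂y`. -/
def v₁ : Derivation ℝ SmoothPlane SmoothPlane := x • dx + y • dy

/-- `v₂ = -y ∂/∂x + x ∂/∂y`. -/
def v₂ : Derivation ℝ SmoothPlane SmoothPlane := -y • dx + x • dy

theorem v₁_v₂ (f : SmoothPlane) : v₁ (v₂ f) = v₂ (v₁ f) := by
  simp [v₁, v₂, dx_x, dx_y, dy_x, dy_y, dx_dy]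
  ring

/-- The submodule `E` of the vector fields on `ℝ²` generated by `v₁` and `v₂`, which is
involutive. -/
def elliptic : LieRinehartSubalgebra SmoothPlane (Derivation ℝ SmoothPlane SmoothPlane) where
  toSubmodule := Submodule.span SmoothPlane {v₁, v₂}
  lie_mem' := by
    intro a b ha hb
    change a ∈ Submodule.span SmoothPlane {v₁, v₂} at ha
    change b ∈ Submodule.span SmoothPlane {v₁, v₂} at hb
    change ⁅a, b⁆ ∈ Submodule.span SmoothPlane {v₁, v₂}
    rw [Submodule.mem_span_pair] at ha hb ⊢
    obtain ⟨a₁, a₂, rfl⟩ := ha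
    obtain ⟨b₁, b₂, rfl⟩ := hb
    refine ⟨(a₁ • v₁ + a₂ • v₂) b₁ - (b₁ • v₁ + b₂ • v₂) a₁,
      (a₁ • v₁ + a₂ • v₂) b₂ - (b₁ • v₁ + b₂ • v₂) a₂, ?_⟩
    refine Derivation.ext fun f => ?_
    simp only [Derivation.commutator_apply, Derivation.add_apply, Derivation.smul_apply,
      smul_eq_mul, Derivation.leibniz, map_add, v₁_v₂]
    ring

/-- `E` is free with basis `v₁`, `v₂`. -/
theorem v₁_v₂_independent (a b : SmoothPlane) (h : a • v₁ + b • v₂ = 0) : a = 0 ∧ b = 0 := by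
  have hx : a * x - b * y = 0 := by
    have := DFunLike.congr_fun h x
    simpa [v₁, v₂, dx_x, dy_x, sub_eq_add_neg] using this
  have hy : a * y + b * x = 0 := by
    have := DFunLike.congr_fun h y
    simpa [v₁, v₂, dx_y, dy_y] using this
  have key : ∀ c : SmoothPlane, c * (x ^ 2 + y ^ 2) = 0 → c = 0 := by
    intro c hc
    have hd : Dense ({0}ᶜ : Set (ℝ × ℝ)) := dense_compl_singleton 0
    have : (c : ℝ × ℝ → ℝ) = fun _ => 0 := by
      refine c.contDiff.continuous.ext_on hd continuous_const fun p hp => ?_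
      have h1 : c p * (p.1 ^ 2 + p.2 ^ 2) = 0 := DFunLike.congr_fun hc p
      rcases mul_eq_zero.1 h1 with h2 | h2
      · exact h2
      · exact absurd (Prod.ext (by simp; nlinarith [sq_nonneg p.1, sq_nonneg p.2])
          (by simp; nlinarith [sq_nonneg p.1, sq_nonneg p.2])) hp
    ext p
    exact congrFun this p
  exact ⟨key a (by linear_combination x * hx + y * hy),
    key b (by linear_combination x * hy - y * hx)⟩

/-- The Poisson structure `Π_E = v₁ ∧ v₂` on `ℝ²`. -/
def ellipticPoisson : PoissonStructure SmoothPlane := PoissonStructure.wedge v₁ v₂ v₁_v₂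

/-- `Π_E = (x² + y²) ∂/∂x ∧ ∂/∂y`. -/
theorem ellipticPoisson_bracket (f g : SmoothPlane) :
    ellipticPoisson.bracket f g = (x ^ 2 + y ^ 2) * (dx f * dy g - dy f * dx g) := by
  change v₁ f * v₂ g - v₂ f * v₁ g = _
  simp [v₁, v₂]
  ring

end SmoothPlane

end

/-! In both complexes every cochain of degree 2 is a cocycle and is determined by one function, its
coefficient on `v₁* ∧ v₂*` or on `∂/∂x ∧ ∂/∂y`. So each cohomology group is the space of smooth
functions modulo the image of a first order operator.

For `E`, the operator sends `b v₁* + c v₂*` to `v₁ c - v₂ b`. This vanishes at the origin because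
both fields do. Conversely the Euler field alone reaches every function vanishing at the origin
(`exists_v₁_eq`, by Hadamard's lemma and integration along rays). Evaluation at the origin thus
identifies the quotient with `ℝ`.

For the Poisson structure, the operator sends `X = u ∂/∂x + w ∂/∂y` to `(x² + y²) div X - 2 (x u + y
w)`. Both the value and the Laplacian of this function vanish at the origin
(`coeff_laplacian_apply_zero`), and these are the only obstructions (`exists_coeff_eq`), so the
quotient is `ℝ²`. Comparing dimensions finishes the proof. -/

noncomputable section
open scoped Manifold ContDiff

/-! ### Smooth dependence of integrals on parameters. -/

section ParametricIntegral

open MeasureTheory Set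

variable {H F : Type} [NormedAddCommGroup H] [NormedSpace ℝ H] [ProperSpace H]
  [NormedAddCommGroup F] [NormedSpace ℝ F]

/-- Differentiation under the integral sign for a jointly `C¹` integrand on `[0, 1]`. -/
theorem hasFDerivAt_integral_of_contDiff {f : H × ℝ → F} (hf : ContDiff ℝ 1 f) (x₀ : H) :
    HasFDerivAt (fun x => ∫ t in (0 : ℝ)..1, f (x, t))
      (∫ t in (0 : ℝ)..1, (fderiv ℝ f (x₀, t)).comp (ContinuousLinearMap.inl ℝ H ℝ)) x₀ := by
  have hcont : Continuous fun q : H × ℝ =>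
      (fderiv ℝ f q).comp (ContinuousLinearMap.inl ℝ H ℝ) :=
    (hf.continuous_fderiv (by simp)).clm_comp continuous_const
  -- The closed unit ball is compact because `H` is proper, so a constant dominates the partial
  -- derivative near `x₀`.
  obtain ⟨C, hC⟩ := ((isCompact_closedBall x₀ 1).prod
    (isCompact_Icc (a := (0 : ℝ)) (b := 1))).exists_bound_of_continuousOn hcont.continuousOn
  have hline (x : H) : Continuous fun t : ℝ => (x, t) := by fun_prop
  refine intervalIntegral.hasFDerivAt_integral_of_dominated_of_fderiv_le
    (F := fun x t => f (x, t)) (bound := fun _ => C)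
    (F' := fun x t => (fderiv ℝ f (x, t)).comp (ContinuousLinearMap.inl ℝ H ℝ))
    (Metric.closedBall_mem_nhds x₀ one_pos) ?_ ?_ ?_ ?_ ?_ ?_
  · exact .of_forall fun x => (hf.continuous.comp (hline x)).aestronglyMeasurable
  · exact (hf.continuous.comp (hline x₀)).intervalIntegrable _ _
  · exact (hcont.comp (hline x₀)).aestronglyMeasurable
  · refine .of_forall fun t ht x hx => hC (x, t) ⟨hx, ?_⟩
    rw [uIoc_of_le zero_le_one] at ht
    exact Ioc_subset_Icc_self ht
  · exact intervalIntegrable_const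
  · refine .of_forall fun t _ x _ => ?_
    exact (hf.differentiable (by simp) (x, t)).hasFDerivAt.comp x (hasFDerivAt_prodMk_left x t)

/-- The codomain is quantified after `n` because the inductive step passes to the derivative, whose
values lie in the continuous linear maps from `H` to `F`. -/
theorem contDiff_integral_of_contDiff_nat (n : ℕ) : ∀ {F : Type} [NormedAddCommGroup F]
    [NormedSpace ℝ F] {f : H × ℝ → F}, ContDiff ℝ ∞ f →
      ContDiff ℝ n (fun x => ∫ t in (0 : ℝ)..1, f (x, t)) := by
  induction n with
  | zero =>
    intro F _ _ f hf
    refine contDiff_zero.2 (Differentiable.continuous (𝕜 := ℝ) fun x => ?_)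
    exact (hasFDerivAt_integral_of_contDiff (hf.of_le (mod_cast le_top)) x).differentiableAt
  | succ n ih =>
    intro F _ _ f hf
    have hd := hasFDerivAt_integral_of_contDiff (hf.of_le (mod_cast le_top))
    push_cast
    refine (contDiff_succ_iff_fderiv).2 ⟨fun x => (hd x).differentiableAt, by simp, ?_⟩
    rw [funext fun x => (hd x).fderiv]
    exact ih ((hf.fderiv_right (m := ∞) (by simp)).clm_comp contDiff_const)

/-- The integral over `[0, 1]` of a jointly smooth function depends smoothly on the parameter. -/
theorem contDiff_integral_of_contDiff {f : H × ℝ → F} (hf : ContDiff ℝ ∞ f) :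
    ContDiff ℝ ∞ (fun x => ∫ t in (0 : ℝ)..1, f (x, t)) :=
  contDiff_infty.2 fun n => contDiff_integral_of_contDiff_nat n hf

end ParametricIntegral

/-! ### Hadamard's lemma, the Euler field, and derivations of smooth functions. -/

namespace SmoothPlane

@[simp] theorem x_apply (p : ℝ × ℝ) : x p = p.1 := rfl
@[simp] theorem y_apply (p : ℝ × ℝ) : y p = p.2 := rfl
@[simp] theorem add_apply (f g : SmoothPlane) (p : ℝ × ℝ) : (f + g) p = f p + g p := rfl
@[simp] theorem sub_apply (f g : SmoothPlane) (p : ℝ × ℝ) : (f - g) p = f p - g p := rfl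
@[simp] theorem mul_apply (f g : SmoothPlane) (p : ℝ × ℝ) : (f * g) p = f p * g p := rfl
@[simp] theorem algebraMap_apply (r : ℝ) (p : ℝ × ℝ) : algebraMap ℝ SmoothPlane r p = r := rfl

theorem fderiv_eq (f : SmoothPlane) (p u : ℝ × ℝ) :
    fderiv ℝ f p u = u.1 * dx f p + u.2 * dy f p := by
  change _ = u.1 * fderiv ℝ f p (1, 0) + u.2 * fderiv ℝ f p (0, 1)
  rw [← smul_eq_mul, ← smul_eq_mul, ← map_smul, ← map_smul, ← map_add]
  simp

/-- The mean of `f` over the segment from `c` to the variable point. -/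
def segmentMean (c : ℝ × ℝ) (f : SmoothPlane) : SmoothPlane :=
  ⟨fun p => ∫ t in (0 : ℝ)..1, f (c + t • (p - c)), by
    refine (contDiff_integral_of_contDiff
      (f := fun q : (ℝ × ℝ) × ℝ => f (c + q.2 • (q.1 - c))) ?_).contMDiff
    exact f.contDiff.comp (by fun_prop)⟩

theorem segmentMean_apply (c : ℝ × ℝ) (f : SmoothPlane) (p : ℝ × ℝ) :
    segmentMean c f p = ∫ t in (0 : ℝ)..1, f (c + t • (p - c)) := rfl

theorem segmentMean_self (c : ℝ × ℝ) (f : SmoothPlane) : segmentMean c f c = f c := by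
  simp [segmentMean_apply]

/-- Hadamard's lemma. -/
theorem eq_add_segmentMean (c : ℝ × ℝ) (f : SmoothPlane) :
    f = algebraMap ℝ _ (f c) + (x - algebraMap ℝ _ c.1) * segmentMean c (dx f)
      + (y - algebraMap ℝ _ c.2) * segmentMean c (dy f) := by
  ext p
  have hline : Continuous fun t : ℝ => c + t • (p - c) := by fun_prop
  have hint (g : SmoothPlane) (r : ℝ) : IntervalIntegrable
      (fun t : ℝ => r * g (c + t • (p - c))) MeasureTheory.volume 0 1 :=
    (continuous_const.mul (g.contDiff.continuous.comp hline)).intervalIntegrable _ _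
  have hderiv (t : ℝ) : HasDerivAt (fun t : ℝ => f (c + t • (p - c)))
      ((p.1 - c.1) * dx f (c + t • (p - c)) + (p.2 - c.2) * dy f (c + t • (p - c))) t := by
    have h1 : HasDerivAt (fun t : ℝ => c + t • (p - c)) (p - c) t := by
      simpa using ((hasDerivAt_id t).smul_const (p - c)).const_add c
    have := (f.differentiableAt _).hasFDerivAt.comp_hasDerivAt t h1
    rwa [fderiv_eq] at this
  have := intervalIntegral.integral_eq_sub_of_hasDerivAt (a := 0) (b := 1)
    (fun t _ => hderiv t) ((hint _ _).add (hint _ _))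
  rw [intervalIntegral.integral_add (hint _ _) (hint _ _),
    intervalIntegral.integral_const_mul, intervalIntegral.integral_const_mul] at this
  simp only [add_apply, mul_apply, sub_apply, x_apply, y_apply, algebraMap_apply,
    segmentMean_apply]
  simp only [one_smul, add_sub_cancel, zero_smul, add_zero] at this
  linarith

/-- The Euler vector field maps onto the functions that vanish at the origin. -/
theorem exists_v₁_eq (a : SmoothPlane) (ha : a 0 = 0) : ∃ g, v₁ g = a := by
  have had := eq_add_segmentMean 0 a
  set b := segmentMean 0 (dx a)
  set c := segmentMean 0 (dy a)
  -- This is `∫₀¹ a(t p) / t dt`, the solution along rays, written without division by means of `a =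
  -- x b + y c`.
  refine ⟨x * segmentMean 0 b + y * segmentMean 0 c, ?_⟩
  set g := x * segmentMean 0 b + y * segmentMean 0 c with hg
  ext p
  have hcont : Continuous fun t : ℝ => p.1 * b (t • p) + p.2 * c (t • p) :=
    (continuous_const.mul (b.contDiff.continuous.comp (by fun_prop))).add
      (continuous_const.mul (c.contDiff.continuous.comp (by fun_prop)))
  have hint (g : SmoothPlane) (r s : ℝ) : IntervalIntegrable
      (fun t : ℝ => r * g ((s * t) • p)) MeasureTheory.volume 0 1 :=
    (continuous_const.mul (g.contDiff.continuous.comp (by fun_prop))).intervalIntegrable _ _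
  -- Rescaling moves `s` into the upper limit. The derivative at `s = 1` is then `a p` by the
  -- fundamental theorem of calculus and `v₁ g p` by the chain rule.
  have hray (s : ℝ) : g (s • p) = ∫ t in (0 : ℝ)..s, p.1 * b (t • p) + p.2 * c (t • p) := by
    have := intervalIntegral.mul_integral_comp_mul_left (a := 0) (b := 1) (c := s)
      (f := fun t : ℝ => p.1 * b (t • p) + p.2 * c (t • p))
    rw [mul_zero, mul_one] at this
    rw [← this, intervalIntegral.integral_add (hint _ _ _) (hint _ _ _),
      intervalIntegral.integral_const_mul, intervalIntegral.integral_const_mul]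
    simp only [hg, add_apply, mul_apply, x_apply, y_apply, segmentMean_apply, sub_zero, zero_add,
      smul_smul, Prod.smul_fst, Prod.smul_snd, smul_eq_mul, mul_comm s]
    ring
  have h1 : HasDerivAt (fun s : ℝ => g (s • p)) (p.1 * b p + p.2 * c p) 1 := by
    have := intervalIntegral.integral_hasDerivAt_right (hcont.intervalIntegrable 0 1)
      (hcont.stronglyMeasurableAtFilter _ _) hcont.continuousAt (b := 1)
    simpa [hray] using this
  have h2 : HasDerivAt (fun s : ℝ => g (s • p)) (p.1 * dx g p + p.2 * dy g p) 1 := by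
    have h : HasDerivAt (fun t : ℝ => t • p) p 1 := by
      simpa using (hasDerivAt_id (1 : ℝ)).smul_const p
    have := (g.differentiableAt _).hasFDerivAt.comp_hasDerivAt 1 h
    rwa [fderiv_eq, one_smul] at this
  rw [had]
  have := h2.unique h1
  simpa [v₁, ha] using this

/-- Every derivation of the smooth functions on the plane is a vector field. -/
theorem derivation_apply_eq (D : Derivation ℝ SmoothPlane SmoothPlane) (f : SmoothPlane) :
    D f = dx f * D x + dy f * D y := by
  ext c
  -- Hadamard's expansion is centred at the evaluation point `c`: the terms where `D` hits a mean
  -- carry a factor vanishing at `c`, and the means themselves take the values of `dx f` and `dy f`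
  -- there.
  have := congrArg D (eq_add_segmentMean c f)
  simp only [map_add, map_sub, Derivation.leibniz, Derivation.map_algebraMap] at this
  rw [this]
  simp [segmentMean_self]

end SmoothPlane
end

noncomputable section

/-! ### The Koszul formula in degrees 1 and 2. -/

section Koszul

variable {L M : Type*} [AddCommGroup M] (br : L → L → L) (act : L → M → M)

theorem koszul_fin_one (ω : (Fin 1 → L) → M) (V : Fin 2 → L) :
    koszul br act ω V =
      act (V 0) (ω ![V 1]) - act (V 1) (ω ![V 0]) - ω ![br (V 0) (V 1)] := by
  have h0 : (0 : Fin 2).removeNth V = ![V 1] := by ext i; fin_cases i; rfl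
  have h1 : (1 : Fin 2).removeNth V = ![V 0] := by ext i; fin_cases i; rfl
  have hb (v : L) (W : Fin 0 → L) : (Fin.cons v W : Fin 1 → L) = ![v] := by
    ext i; fin_cases i; rfl
  simp [koszul, koszulAction, koszulBracket, Fin.sum_univ_succ, h0, h1, hb]
  abel

theorem koszul_fin_two (ω : (Fin 2 → L) → M) (V : Fin 3 → L) :
    koszul br act ω V =
      act (V 0) (ω ![V 1, V 2]) - act (V 1) (ω ![V 0, V 2]) + act (V 2) (ω ![V 0, V 1])
        - ω ![br (V 0) (V 1), V 2] + ω ![br (V 0) (V 2), V 1] - ω ![br (V 1) (V 2), V 0] := by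
  have h0 : (0 : Fin 3).removeNth V = ![V 1, V 2] := by ext i; fin_cases i <;> rfl
  have h1 : (1 : Fin 3).removeNth V = ![V 0, V 2] := by ext i; fin_cases i <;> rfl
  have h2 : (2 : Fin 3).removeNth V = ![V 0, V 1] := by ext i; fin_cases i <;> rfl
  have k0 (W : Fin 2 → L) : (0 : Fin 2).removeNth W = ![W 1] := by ext i; fin_cases i; rfl
  have k1 (W : Fin 2 → L) : (1 : Fin 2).removeNth W = ![W 0] := by ext i; fin_cases i; rfl
  have hb (v w : L) : (Fin.cons v ![w] : Fin 2 → L) = ![v, w] := by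
    ext i; fin_cases i <;> rfl
  have lt1 : (1 : Fin 2).castSucc < (2 : Fin 3) := by decide
  have nlt1 : ¬ (1 : Fin 2).castSucc < (1 : Fin 3) := by decide
  have nlt0 : ¬ (1 : Fin 2).castSucc < (0 : Fin 3) := by decide
  have c1 : (1 : Fin 2).castSucc = (1 : Fin 3) := rfl
  change (∑ i : Fin 3, _) + (∑ j : Fin 3, ∑ i : Fin 2, _) = _
  simp only [Fin.sum_univ_three, Fin.sum_univ_two, h0, h1, h2, k0, k1, hb, lt1, nlt1, nlt0,
    if_true, if_false]
  simp [c1]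
  abel

end Koszul

/-! ### Cohomology in a degree where all cochains are closed. -/

section Cohomology

variable {R : Type*} [CommRing R] {C : ℕ → Type*} [∀ p, AddCommGroup (C p)] [∀ p, Module R (C p)]
  {N : Type*} [AddCommGroup N] [Module R N]

/-- If every cochain of degree `p` is a cocycle, a surjection from the cochains whose kernel is the
space of coboundaries computes the cohomology. -/
theorem nonempty_cohomology_equiv (d : ∀ p, C p →ₗ[R] C (p + 1)) (Ω : ∀ p, Submodule R (C p))
    (p : ℕ) (φ : C p →ₗ[R] N) (hd : ∀ ω ∈ Ω p, d p ω = 0) (hφ : ∀ n, ∃ ω ∈ Ω p, φ ω = n)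
    (hker : ∀ ω ∈ Ω p, φ ω = 0 ↔ ω ∈ coboundaries d Ω p) :
    Nonempty (cohomology d Ω p ≃ₗ[R] N) := by
  have hsurj : Function.Surjective (φ.domRestrict (cocycles d Ω p)) := fun n => by
    obtain ⟨ω, hω, h⟩ := hφ n
    exact ⟨⟨ω, hω, hd ω hω⟩, h⟩
  refine ⟨(Submodule.quotEquivOfEq _ _ ?_).trans (LinearMap.quotKerEquivOfSurjective _ hsurj)⟩
  ext ω
  exact (hker ω ω.2.1).symm

end Cohomology

namespace SmoothPlane

/-! ### `E`-cohomology in degree 2. -/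

section ECohomology

theorem v₁_mem : v₁ ∈ elliptic := Submodule.subset_span (by simp)

theorem v₂_mem : v₂ ∈ elliptic := Submodule.subset_span (by simp)

/-- The basis `v₁`, `v₂` of `E`. -/
def ellipticBasis : Module.Basis (Fin 2) SmoothPlane elliptic :=
  Module.Basis.mk (v := ![⟨v₁, v₁_mem⟩, ⟨v₂, v₂_mem⟩])
    (LinearIndependent.pair_iff.2 fun a b h => v₁_v₂_independent a b (congrArg Subtype.val h))
    (by
      rintro ⟨V, hV⟩ -
      obtain ⟨a, b, rfl⟩ := Submodule.mem_span_pair.1 hV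
      rw [Matrix.range_cons, Matrix.range_cons, Matrix.range_empty, Set.union_empty,
        Set.singleton_union]
      exact Submodule.mem_span_pair.2 ⟨a, b, rfl⟩)

theorem coe_ellipticBasis_zero : (ellipticBasis 0 : Derivation ℝ SmoothPlane SmoothPlane) = v₁ := by
  simp [ellipticBasis]

theorem coe_ellipticBasis_one : (ellipticBasis 1 : Derivation ℝ SmoothPlane SmoothPlane) = v₂ := by
  simp [ellipticBasis]

theorem elliptic_coe_eq (V : elliptic) : (V : Derivation ℝ SmoothPlane SmoothPlane) =
    ellipticBasis.repr V 0 • v₁ + ellipticBasis.repr V 1 • v₂ := by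
  have := congrArg Subtype.val (ellipticBasis.sum_repr V)
  rw [Fin.sum_univ_two] at this
  rw [← coe_ellipticBasis_zero, ← coe_ellipticBasis_one]
  exact this.symm

theorem elliptic_apply_eq (V : elliptic) (f : SmoothPlane) :
    (V : Derivation ℝ SmoothPlane SmoothPlane) f =
      ellipticBasis.repr V 0 * v₁ f + ellipticBasis.repr V 1 * v₂ f := by
  rw [elliptic_coe_eq V]; rfl

/-- No structure functions appear because `v₁` and `v₂` commute; coordinates are compared through
the independence of the two fields. -/
theorem ellipticBasis_repr_lie (V W : elliptic) (i : Fin 2) :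
    ellipticBasis.repr ⁅V, W⁆ i =
      (V : Derivation ℝ SmoothPlane SmoothPlane) (ellipticBasis.repr W i) -
        (W : Derivation ℝ SmoothPlane SmoothPlane) (ellipticBasis.repr V i) := by
  have h := v₁_v₂_independent
    (ellipticBasis.repr ⁅V, W⁆ 0 -
      ((V : Derivation ℝ SmoothPlane SmoothPlane) (ellipticBasis.repr W 0) -
        (W : Derivation ℝ SmoothPlane SmoothPlane) (ellipticBasis.repr V 0)))
    (ellipticBasis.repr ⁅V, W⁆ 1 -
      ((V : Derivation ℝ SmoothPlane SmoothPlane) (ellipticBasis.repr W 1) -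
        (W : Derivation ℝ SmoothPlane SmoothPlane) (ellipticBasis.repr V 1))) (by
    refine Derivation.ext fun f => ?_
    have h : ellipticBasis.repr ⁅V, W⁆ 0 * v₁ f + ellipticBasis.repr ⁅V, W⁆ 1 * v₂ f =
        (V : Derivation ℝ SmoothPlane SmoothPlane) ((W : Derivation ℝ SmoothPlane SmoothPlane) f) -
        (W : Derivation ℝ SmoothPlane SmoothPlane) ((V : Derivation ℝ SmoothPlane SmoothPlane) f) :=
      (elliptic_apply_eq ⁅V, W⁆ f).symm.trans (Derivation.commutator_apply ..)
    simp only [elliptic_apply_eq, map_add, Derivation.leibniz, smul_eq_mul, v₁_v₂] at h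
    simp only [Derivation.add_apply, Derivation.smul_apply, smul_eq_mul, elliptic_apply_eq,
      Derivation.zero_apply]
    linear_combination h)
  fin_cases i
  · exact sub_eq_zero.1 h.1
  · exact sub_eq_zero.1 h.2

/-- The determinant of the basis plays the role of `v₁* ∧ v₂*`. -/
theorem ellipticBasis_det (V : Fin 2 → elliptic) : ellipticBasis.det V =
    ellipticBasis.repr (V 0) 0 * ellipticBasis.repr (V 1) 1 -
      ellipticBasis.repr (V 1) 0 * ellipticBasis.repr (V 0) 1 := by
  rw [Module.Basis.det_apply, Matrix.det_fin_two]
  rfl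

/-- The differential of the `E`-form `b v₁* + c v₂*`. -/
theorem EForm_d_one (b c : SmoothPlane) :
    EForm.d elliptic 1 (fun V => b * ellipticBasis.repr (V 0) 0 + c * ellipticBasis.repr (V 0) 1) =
      ⇑((v₁ c - v₂ b) • ellipticBasis.det) := by
  funext V
  change koszul _ _ _ _ = (v₁ c - v₂ b) * ellipticBasis.det V
  rw [koszul_fin_one, ellipticBasis_det]
  simp only [Matrix.cons_val_zero, ellipticBasis_repr_lie, Derivation.coeFn_coe, elliptic_apply_eq,
    map_add, Derivation.leibniz, smul_eq_mul]
  ring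

/-- Conceptually, rank two leaves no alternating 3-forms. Here a 2-form is written as a function
times the determinant, and the Koszul formula cancels term by term. -/
theorem EForm_d_two (ω : (Fin 2 → elliptic) → SmoothPlane) (hω : ω ∈ EForm elliptic 2) :
    EForm.d elliptic 2 ω = 0 := by
  obtain ⟨α, rfl⟩ := hω
  have hα (V W : elliptic) : α ![V, W] = α ellipticBasis *
      (ellipticBasis.repr V 0 * ellipticBasis.repr W 1 -
        ellipticBasis.repr W 0 * ellipticBasis.repr V 1) := by
    conv_lhs => rw [α.eq_smul_basis_det ellipticBasis]
    rw [AlternatingMap.smul_apply, ellipticBasis_det]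
    rfl
  funext V
  change koszul _ _ _ _ = 0
  rw [koszul_fin_two]
  simp only [hα, ellipticBasis_repr_lie, Derivation.coeFn_coe, elliptic_apply_eq,
    map_sub, Derivation.leibniz, smul_eq_mul]
  ring

theorem exists_of_mem_EForm_one {ω : (Fin 1 → elliptic) → SmoothPlane}
    (hω : ω ∈ EForm elliptic 1) : ∃ b c, ω = fun V =>
      b * ellipticBasis.repr (V 0) 0 + c * ellipticBasis.repr (V 0) 1 := by
  obtain ⟨α, rfl⟩ := hω
  obtain ⟨l, rfl⟩ := (AlternatingMap.ofSubsingleton SmoothPlane elliptic SmoothPlane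
    (0 : Fin 1)).surjective α
  refine ⟨l (ellipticBasis 0), l (ellipticBasis 1), ?_⟩
  funext V
  have := congrArg l (ellipticBasis.sum_repr (V 0))
  rw [Fin.sum_univ_two, map_add, map_smul, map_smul, smul_eq_mul, smul_eq_mul] at this
  change l (V 0) = _
  rw [← this]
  ring

theorem mem_EForm_one (b c : SmoothPlane) : (fun V : Fin 1 → elliptic =>
    b * ellipticBasis.repr (V 0) 0 + c * ellipticBasis.repr (V 0) 1) ∈ EForm elliptic 1 :=
  ⟨AlternatingMap.ofSubsingleton SmoothPlane elliptic SmoothPlane (0 : Fin 1)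
    (b • ellipticBasis.coord 0 + c • ellipticBasis.coord 1), rfl⟩

theorem v₁_apply_zero (f : SmoothPlane) : v₁ f 0 = 0 := by simp [v₁]

theorem v₂_apply_zero (f : SmoothPlane) : v₂ f 0 = 0 := by simp [v₂]

/-- The value at the origin of the coefficient of an `E`-form of degree `2`. -/
def EForm.coeffAtZero : ((Fin 2 → elliptic) → SmoothPlane) →ₗ[ℝ] ℝ where
  toFun ω := ω ellipticBasis 0
  map_add' _ _ := rfl
  map_smul' _ _ := rfl

theorem nonempty_ECohomology_two_equiv : Nonempty (ECohomology elliptic 2 ≃ₗ[ℝ] ℝ) := by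
  refine nonempty_cohomology_equiv _ _ _ EForm.coeffAtZero EForm_d_two (fun r => ?_)
    fun ω hω => ⟨fun h => ⟨hω, ?_⟩, ?_⟩
  · refine ⟨_, ⟨algebraMap ℝ SmoothPlane r • ellipticBasis.det, rfl⟩, ?_⟩
    change (algebraMap ℝ SmoothPlane r * ellipticBasis.det ellipticBasis) 0 = r
    simp [Module.Basis.det_self]
  · obtain ⟨α, rfl⟩ := hω
    obtain ⟨g, hg⟩ := exists_v₁_eq (α ellipticBasis) h
    -- The differential of `g v₂*` has coefficient `v₁ g`, so no `v₁*` component is needed.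
    refine ⟨_, mem_EForm_one 0 g, ?_⟩
    rw [EForm_d_one, map_zero, sub_zero, hg, ← α.eq_smul_basis_det]
  · rintro ⟨-, η, hη, rfl⟩
    obtain ⟨b, c, rfl⟩ := exists_of_mem_EForm_one hη
    rw [EForm_d_one]
    change ((v₁ c - v₂ b) * ellipticBasis.det ellipticBasis) 0 = 0
    simp [v₁_apply_zero, v₂_apply_zero]

end ECohomology

/-! ### Poisson cohomology in degree 2. -/

section PoissonCohomology

theorem update_vec_one {α : Type*} (a b : α) : Function.update ![a] 0 b = ![b] := by
  ext i; fin_cases i; rfl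

theorem update_vec_two {α : Type*} (a b c : α) : Function.update ![a, c] 0 b = ![b, c] := by
  ext i; fin_cases i <;> rfl

/-- A multivector field of degree `1` is a derivation. -/
def Multivector.toDerivation (P : (Fin 1 → SmoothPlane) → SmoothPlane)
    (hP : P ∈ Multivector SmoothPlane 1) : Derivation ℝ SmoothPlane SmoothPlane :=
  Derivation.mk'
    { toFun := fun f => P ![f]
      map_add' := fun f g => by
        obtain ⟨Q, rfl⟩ := hP.1
        simpa only [update_vec_one] using Q.map_update_add ![0] 0 f g
      map_smul' := fun r f => by
        obtain ⟨Q, rfl⟩ := hP.1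
        simpa only [update_vec_one, RingHom.id_apply] using Q.map_update_smul ![0] 0 r f }
    (fun f g => by
      have := hP.2 ![0] 0 f g
      rwa [update_vec_one, update_vec_one, update_vec_one] at this)

/-- A bivector field with its second argument fixed, as a derivation. -/
def Multivector.contract (P : (Fin 2 → SmoothPlane) → SmoothPlane)
    (hP : P ∈ Multivector SmoothPlane 2) (h : SmoothPlane) :
    Derivation ℝ SmoothPlane SmoothPlane :=
  Derivation.mk'
    { toFun := fun f => P ![f, h]
      map_add' := fun f g => by
        obtain ⟨Q, rfl⟩ := hP.1
        simpa only [update_vec_two] using Q.map_update_add ![0, h] 0 f g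
      map_smul' := fun r f => by
        obtain ⟨Q, rfl⟩ := hP.1
        simpa only [update_vec_two, RingHom.id_apply] using Q.map_update_smul ![0, h] 0 r f }
    (fun f g => by
      have := hP.2 ![0, h] 0 f g
      rwa [update_vec_two, update_vec_two, update_vec_two] at this)

theorem Multivector.apply_swap {P : (Fin 2 → SmoothPlane) → SmoothPlane}
    (hP : P ∈ Multivector SmoothPlane 2) (f g : SmoothPlane) : P ![f, g] = -P ![g, f] := by
  obtain ⟨Q, rfl⟩ := hP.1
  have := Q.map_swap ![g, f] (i := 0) (j := 1) (by decide)
  rw [← this]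
  congr 1
  ext i
  fin_cases i <;> rfl

theorem Multivector.apply_self {P : (Fin 2 → SmoothPlane) → SmoothPlane}
    (hP : P ∈ Multivector SmoothPlane 2) (f : SmoothPlane) : P ![f, f] = 0 := by
  obtain ⟨Q, rfl⟩ := hP.1
  exact Q.map_eq_zero_of_eq _ (i := 0) (j := 1) rfl (by decide)

/-- Every bivector field is `φ ∂/∂x ∧ ∂/∂y`. -/
theorem Multivector.apply_two {P : (Fin 2 → SmoothPlane) → SmoothPlane}
    (hP : P ∈ Multivector SmoothPlane 2) (f g : SmoothPlane) :
    P ![f, g] = P ![x, y] * (dx f * dy g - dy f * dx g) := by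
  have h (f g : SmoothPlane) : P ![f, g] = dx f * P ![x, g] + dy f * P ![y, g] :=
    derivation_apply_eq (Multivector.contract P hP g) f
  -- The derivation property is only available in the first slot, so antisymmetry carries `g` there.
  rw [h f g, apply_swap hP x g, apply_swap hP y g, h g x, h g y, apply_self hP, apply_self hP,
    apply_swap hP y x]
  ring

/-- The Poisson differential of the vector field `u ∂/∂x + w ∂/∂y`. -/
theorem Multivector_d_one (u w : SmoothPlane) (F : Fin 2 → SmoothPlane) :
    Multivector.d ellipticPoisson 1 (fun F => dx (F 0) * u + dy (F 0) * w) F =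
      ((x ^ 2 + y ^ 2) * (dx u + dy w) - 2 * (x * u + y * w)) *
        (dx (F 0) * dy (F 1) - dy (F 0) * dx (F 1)) := by
  change koszul _ _ _ _ = _
  rw [koszul_fin_one]
  simp only [Matrix.cons_val_zero, ellipticPoisson_bracket, map_add, map_sub, Derivation.leibniz,
    Derivation.leibniz_pow, smul_eq_mul, nsmul_eq_mul, dx_dy, dx_x, dx_y, dy_x, dy_y]
  push_cast
  ring

theorem Multivector_d_two (P : (Fin 2 → SmoothPlane) → SmoothPlane)
    (hP : P ∈ Multivector SmoothPlane 2) : Multivector.d ellipticPoisson 2 P = 0 := by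
  -- With the coefficient hidden behind `φ`, the rewriting rule no longer applies to its own
  -- right-hand side.
  obtain ⟨φ, hφ⟩ : ∃ φ, ∀ f g, P ![f, g] = φ * (dx f * dy g - dy f * dx g) :=
    ⟨_, Multivector.apply_two hP⟩
  funext F
  change koszul _ _ _ _ = 0
  rw [koszul_fin_two]
  simp only [hφ, ellipticPoisson_bracket, map_add, map_sub,
    Derivation.leibniz, Derivation.leibniz_pow, smul_eq_mul, nsmul_eq_mul, dx_dy, dx_x, dx_y, dy_x,
    dy_y]
  push_cast
  ring

theorem exists_of_mem_Multivector_one {P : (Fin 1 → SmoothPlane) → SmoothPlane}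
    (hP : P ∈ Multivector SmoothPlane 1) :
    ∃ u w, P = fun F => dx (F 0) * u + dy (F 0) * w := by
  refine ⟨P ![x], P ![y], funext fun F => ?_⟩
  have hF : F = ![F 0] := by ext i; fin_cases i; rfl
  conv_lhs => rw [hF]
  exact derivation_apply_eq (Multivector.toDerivation P hP) (F 0)

theorem mem_Multivector_one (u w : SmoothPlane) :
    (fun F : Fin 1 → SmoothPlane => dx (F 0) * u + dy (F 0) * w) ∈ Multivector SmoothPlane 1 := by
  refine ⟨⟨AlternatingMap.ofSubsingleton ℝ SmoothPlane SmoothPlane (0 : Fin 1)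
    ((u • dx + w • dy : Derivation ℝ SmoothPlane SmoothPlane) : SmoothPlane →ₗ[ℝ] SmoothPlane),
    ?_⟩, fun F i g h => ?_⟩
  · funext F
    change u * dx (F 0) + w * dy (F 0) = _
    ring
  · obtain rfl : i = 0 := Subsingleton.elim _ _
    simp
    ring

/-- The bivector field `φ ∂/∂x ∧ ∂/∂y`. -/
theorem mem_Multivector_two (φ : SmoothPlane) :
    (fun F : Fin 2 → SmoothPlane => φ * (dx (F 0) * dy (F 1) - dy (F 0) * dx (F 1))) ∈
      Multivector SmoothPlane 2 := by
  refine ⟨⟨{ toFun := fun F => φ * (dx (F 0) * dy (F 1) - dy (F 0) * dx (F 1))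
             map_update_add' := ?_
             map_update_smul' := ?_
             map_eq_zero_of_eq' := ?_ }, rfl⟩, ?_⟩
  · intro inst F i f g
    -- The field is stated for an arbitrary decidability instance; the canonical one lets
    -- `Function.update` be evaluated.
    rw [Subsingleton.elim inst (instDecidableEqFin 2)]
    fin_cases i <;> simp <;> ring
  · intro inst F i r f
    rw [Subsingleton.elim inst (instDecidableEqFin 2)]
    fin_cases i <;> simp [← smul_sub]
  · intro F i j h hij
    fin_cases i <;> fin_cases j <;> simp_all <;> ring
  · intro F i f g
    fin_cases i <;> simp <;> ring

/-- The value and the Laplacian at the origin of the coefficient of a bivector field. -/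
def Multivector.coeffJet : ((Fin 2 → SmoothPlane) → SmoothPlane) →ₗ[ℝ] (Fin 2 → ℝ) where
  toFun P := ![P ![x, y] 0, (dx (dx (P ![x, y])) + dy (dy (P ![x, y]))) 0]
  map_add' P Q := by
    ext i
    fin_cases i
    · simp
    · simp
      ring
  map_smul' r P := by
    ext i
    fin_cases i
    · simp
    · simp
      ring

theorem x_apply_zero : x (0 : ℝ × ℝ) = 0 := rfl

theorem y_apply_zero : y (0 : ℝ × ℝ) = 0 := rfl

/-- Used to match the factor 2 in the term `2 (x u + y w)` of the Poisson differential. -/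
theorem exists_twice_eq (a : SmoothPlane) : ∃ b, a = 2 * b :=
  ⟨(2⁻¹ : ℝ) • a, by
    rw [mul_smul_comm, two_mul, ← two_smul ℝ a, smul_smul]
    norm_num⟩

/-- A function whose value and Laplacian vanish at the origin is the coefficient of the Poisson
differential of a vector field. -/
theorem exists_coeff_eq (a : SmoothPlane) (h0 : a 0 = 0) (hΔ : (dx (dx a) + dy (dy a)) 0 = 0) :
    ∃ u w, (x ^ 2 + y ^ 2) * (dx u + dy w) - 2 * (x * u + y * w) = a := by
  obtain ⟨b, hb⟩ := exists_twice_eq (segmentMean 0 (dx a))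
  obtain ⟨c, hc⟩ := exists_twice_eq (segmentMean 0 (dy a))
  have ha : a = 2 * (x * b + y * c) := by
    have := eq_add_segmentMean 0 a
    rw [h0, hb, hc] at this
    simp only [Prod.fst_zero, Prod.snd_zero, map_zero] at this
    linear_combination this
  -- At the origin the Laplacian of `2 (x b + y c)` is four times the divergence of `(b, c)`, so
  -- `hΔ` is exactly the condition for solving `v₁ h = div (b, c)`.
  have hdiv : (dx b + dy c) 0 = 0 := by
    have hL : dx (dx a) + dy (dy a) = 4 * (dx b + dy c) + x * (2 * (dx (dx b) + dy (dy b))) +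
        y * (2 * (dx (dx c) + dy (dy c))) := by
      rw [ha, two_mul]
      simp only [map_add, Derivation.leibniz, smul_eq_mul, dx_x, dx_y, dy_x, dy_y, map_zero,
        Derivation.map_one_eq_zero]
      ring
    rw [hL] at hΔ
    have h4 : (4 : SmoothPlane) 0 = (4 : ℝ) := by
      rw [← map_ofNat (algebraMap ℝ SmoothPlane) 4, algebraMap_apply]
    rw [add_apply, add_apply, mul_apply, mul_apply x, mul_apply y, x_apply_zero, y_apply_zero,
      h4] at hΔ
    linarith
  obtain ⟨h, hh⟩ := exists_v₁_eq _ hdiv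
  -- For `X = h v₁ - (b, c)` the divergence is `2 h + v₁ h - div (b, c) = 2 h`. The terms in `(x² +
  -- y²) h` then cancel, leaving `2 (x b + y c) = a`.
  refine ⟨h * x - b, h * y - c, ?_⟩
  replace hh : x * dx h + y * dy h = dx b + dy c := hh
  simp only [map_sub, Derivation.leibniz, smul_eq_mul, dx_x, dy_y]
  rw [ha]
  linear_combination (x ^ 2 + y ^ 2) * hh

/-- At the origin, `(x² + y²) div X` and `2 (x u + y w)` both have Laplacian `4 div X`, so the
difference has none. -/
theorem coeff_laplacian_apply_zero (u w : SmoothPlane) :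
    let a := (x ^ 2 + y ^ 2) * (dx u + dy w) - 2 * (x * u + y * w)
    (dx (dx a) + dy (dy a)) 0 = 0 := by
  intro a
  have h : ∃ s t, dx (dx a) + dy (dy a) = x * s + y * t := by
    -- After the two `4 div X` terms cancel, every remaining term of the Laplacian has a factor `x`
    -- or `y`.
    refine ⟨4 * dx (dx u + dy w) + x * (dx (dx (dx u + dy w)) + dy (dy (dx u + dy w)))
      - 2 * (dx (dx u) + dy (dy u)),
      4 * dy (dx u + dy w) + y * (dx (dx (dx u + dy w)) + dy (dy (dx u + dy w)))
      - 2 * (dx (dx w) + dy (dy w)), ?_⟩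
    simp only [a, pow_two, two_mul, map_add, map_sub, Derivation.leibniz, smul_eq_mul, dx_x, dx_y,
      dy_x, dy_y, map_zero, Derivation.map_one_eq_zero]
    ring
  obtain ⟨s, t, h⟩ := h
  rw [h, add_apply, mul_apply, mul_apply, x_apply_zero, y_apply_zero]
  simp

theorem nonempty_PoissonCohomology_two_equiv :
    Nonempty (PoissonCohomology ellipticPoisson 2 ≃ₗ[ℝ] (Fin 2 → ℝ)) := by
  refine nonempty_cohomology_equiv _ _ _ Multivector.coeffJet Multivector_d_two (fun r => ?_)
    fun P hP => ⟨fun h => ⟨hP, ?_⟩, ?_⟩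
  -- The division by 4 compensates for the Laplacian of `x² + y²`, which is 4.
  · refine ⟨_, mem_Multivector_two
      (algebraMap ℝ _ (r 0) + algebraMap ℝ _ (r 1 / 4) * (x ^ 2 + y ^ 2)), ?_⟩
    ext i
    fin_cases i
    · simp [Multivector.coeffJet, dx_x, dx_y, dy_x, dy_y, pow_two]
    · simp [Multivector.coeffJet, dx_x, dx_y, dy_x, dy_y, pow_two]
      ring
  · obtain ⟨u, w, huw⟩ := exists_coeff_eq (P ![x, y]) (congrFun h 0) (congrFun h 1)
    refine ⟨_, mem_Multivector_one u w, funext fun F => ?_⟩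
    have hF : F = ![F 0, F 1] := by ext i; fin_cases i <;> rfl
    rw [Multivector_d_one, huw, ← Multivector.apply_two hP, ← hF]
  · rintro ⟨-, X, hX, rfl⟩
    obtain ⟨u, w, rfl⟩ := exists_of_mem_Multivector_one hX
    ext i
    fin_cases i
    · simp [Multivector.coeffJet, Multivector_d_one, dx_x, dx_y, dy_x, dy_y, pow_two]
    · have := coeff_laplacian_apply_zero u w
      simpa [Multivector.coeffJet, Multivector_d_one, dx_x, dx_y, dy_x, dy_y] using this

end PoissonCohomology

end SmoothPlane
end

theorem mainTheorem5 :
    Nonempty (ECohomology SmoothPlane.elliptic 2 ≃ₗ[ℝ] ℝ) ∧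
    Nonempty (PoissonCohomology SmoothPlane.ellipticPoisson 2 ≃ₗ[ℝ] (Fin 2 → ℝ)) ∧
    IsEmpty (ECohomology SmoothPlane.elliptic 2 ≃ₗ[ℝ]
      PoissonCohomology SmoothPlane.ellipticPoisson 2) ∧
    ¬ ∀ k : ℕ, Nonempty (ECohomology SmoothPlane.elliptic k ≃ₗ[ℝ]
      PoissonCohomology SmoothPlane.ellipticPoisson k) := by
  obtain ⟨e⟩ := SmoothPlane.nonempty_ECohomology_two_equiv
  obtain ⟨e'⟩ := SmoothPlane.nonempty_PoissonCohomology_two_equiv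
  have h : IsEmpty (ECohomology SmoothPlane.elliptic 2 ≃ₗ[ℝ]
      PoissonCohomology SmoothPlane.ellipticPoisson 2) :=
    ⟨fun φ => by simpa using ((e.symm.trans φ).trans e').finrank_eq⟩
  exact ⟨⟨e⟩, ⟨e'⟩, h, fun hall => (hall 2).elim h.elim⟩
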